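/- Let $\mathbb{T}=\mathbb{R}/\mathbb{Z}$ be the circle with the metric $d(x,y)=\Vert x-y\Vert$, where $\Vert x\Vert$ is the distance from $x$ to the nearest integer. For a real number $\alpha$ and a function $\phi:\mathbb{T}\to\mathbb{C}$ put $S_N\phi=\sum_{r=1}^{N}\phi(r\alpha)$ for $N\ge 0$. Write $e(x)=e^{2\pi i x}$, and let $\{\{x\}\}\in[-\tfrac12,\tfrac12)$ denote the representative of $x$ modulo $1$ in that interval. Let $a_0,a_1,a_2,\dots$ be the partial quotients of the continued fraction of $\alpha$, and let $q_0=1$, $q_1=a_1$, $q_n=a_nq_{n-1}+q_{n-2}$ $(n\ge 2)$ be the denominators of its convergents. An irrational $\alpha$ is of constant type if the sequence $(a_n)$ is bounded. The functions $\cot\pi x$ and $1/\{\{x\}\}$ are given the value $0$ at $x=0$ (this value is never used when $\alpha$ is irrational). (Partial Birkhoff summation.) Let $\alpha$ be irrational, and let $\psi,\phi:\mathbb{T}\to\mathbb{C}$ be functions such that $\psi$ is Lipschitz continuous with constant $C\geq 0$ and, for some constant $B$, $|S_N\phi|\le BN$ for all $N\ge 0$. Then $|\psi|:=\sup_{x\in\mathbb{T}}|\psi(x)|$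 is finite, and for every integer $M$ and every $N\ge 0$, with $\psi_M(x):=\psi(Mx)$, $$\left|S_N(\psi_M\phi)\right|\le BN\left(\tfrac12 C\,\Vert M\alpha\Vert\,(N-1)+|\psi|\right).$$ (Sinai & Ulcigrai.) Let $\alpha$ be irrational and of constant type. Then, for all $n\ge 0$, $$S_{q_n-1}\bigl(\cot(\pi x)\,e(q_nx)\bigr)=O(q_n),\qquad S_{q_n-1}\left(\frac{e(q_nx)}{\{\{x\}\}}\right)=O(q_n),\qquad \sum_{u=0}^{q_n-1}\sum_{v=0}^{q_n-1}e^{2\pi i uv\alpha}=O(q_n),$$ where the implied constants may depend on $\alpha$ but not on $n$. -/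

import Mathlib

open scoped NNReal

noncomputable section

namespace CircleRotation

/-! ### Continued fractions -/

/-- The full quotients of a real number: `a'₀ = x` and `a'ₙ₊₁ = 1 / (a'ₙ - ⌊a'ₙ⌋)`. -/
def fullQuotient (x : ℝ) : ℕ → ℝ
  | 0 => x
  | n + 1 => 1 / (fullQuotient x n - ⌊fullQuotient x n⌋)

/-- The partial quotients `aₙ = ⌊a'ₙ⌋`. -/
def partialQuotient (x : ℝ) (n : ℕ) : ℤ := ⌊fullQuotient x n⌋

/-- The quasiperiods, that is, the denominators of the convergents:
`q₀ = 1`, `q₁ = a₁`, `qₙ₊₂ = aₙ₊₂ qₙ₊₁ + qₙ`.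
The partial quotients that occur here are positive when `x` is irrational,
so `Int.toNat` only changes their type. -/
def quasiperiod (x : ℝ) : ℕ → ℕ
  | 0 => 1
  | 1 => (partialQuotient x 1).toNat
  | n + 2 => (partialQuotient x (n + 2)).toNat * quasiperiod x (n + 1) + quasiperiod x n

/-- An irrational number is of constant type when its partial quotients are bounded. -/
def IsConstantType (x : ℝ) : Prop :=
  Irrational x ∧ ∃ A : ℤ, ∀ n : ℕ, partialQuotient x n ≤ A

/-! ### Birkhoff sums over a rotation of the circle -/

/-- The Birkhoff sum `S_N φ = ∑_{r=1}^N φ(rα)` of an observable on the circle `ℝ / ℤ`, over the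
rotation by `α`, started at `0` (the starting point itself is not counted). -/
def birkhoffS (α : ℝ) (φ : UnitAddCircle → ℂ) (N : ℕ) : ℂ :=
  ∑ r ∈ Finset.Icc 1 N, φ (((r : ℝ) * α : ℝ) : UnitAddCircle)

/-! ### Observables -/

/-- The signed fractional part `{{x}} ∈ [-1/2, 1/2)`. -/
def signedFract (x : ℝ) : ℝ := Int.fract x - if 1 / 2 ≤ Int.fract x then 1 else 0

theorem periodic_signedFract : Function.Periodic signedFract 1 := by
  intro x
  simp [signedFract]

theorem periodic_e :
    Function.Periodic (fun x : ℝ => Complex.exp (2 * Real.pi * Complex.I * x)) 1 := by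
  intro x
  have h : (2 * Real.pi * Complex.I * ((x + 1 : ℝ) : ℂ) : ℂ)
      = 2 * Real.pi * Complex.I * x + 2 * Real.pi * Complex.I := by
    push_cast
    ring
  simp only [h, Complex.exp_periodic _]

theorem periodic_cotPi : Function.Periodic (fun x : ℝ => Real.cot (Real.pi * x)) 1 := by
  intro x
  simp only [Real.cot_eq_cos_div_sin, mul_add, mul_one, Real.cos_add_pi, Real.sin_add_pi,
    neg_div_neg_eq]

/-- `e(x) = exp(2πix)` on the circle. -/
def e : UnitAddCircle → ℂ := periodic_e.lift

/-- `cot πx` on the circle (with the value `0` at its pole `x = 0`). -/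
def cotPi : UnitAddCircle → ℝ := periodic_cotPi.lift

/-- The signed coordinate `{{x}}` on the circle. -/
def signedCoord : UnitAddCircle → ℝ := periodic_signedFract.lift

/-- The double exponential sum `∑_{u=0}^{N-1} ∑_{v=0}^{N-1} exp(2πiuvα)`. -/
def exp2 (α : ℝ) (N : ℕ) : ℂ :=
  ∑ u ∈ Finset.range N, ∑ v ∈ Finset.range N,
    Complex.exp (2 * Real.pi * Complex.I * u * v * α)

end CircleRotation

end

namespace CircleRotation

/-! ### Continued fractions -/

/-! The factor `e(qₙx)` moves by only `O(‖qₙα‖) = O(1/qₙ)` per step of the rotation, hence by `O(1)`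
over `qₙ` steps. Abel summation (`norm_birkhoffS_mul_sub_le`) therefore removes it from any sum
whose unweighted version grows linearly.

The core is the linear bound for cotangent sums, `exists_abs_sum_cot_le`. Bounded partial quotients
give `‖rα‖ ≥ c/r`, so the points `rα` with `r ≤ N` are `c/N`-separated and the sum of `1/sin²(πrα)`
is `O(N²)`. Dirichlet's theorem yields `Q ≤ N` with `‖Qα‖ ≤ 1/N`, and then `Q ≥ cN`. Reflection `r ↦
Q - r` cancels the terms before `Q`, and translation by `Q` reduces those after it to the sum of
length `N - Q`. Both comparisons cost `O(N) = O(Q)`, so induction closes.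

The function `1/{{x}}` differs from `π cot πx` by a bounded amount. In the double sum the inner sums
are geometric, and `1/(e(x) - 1) = -1/2 - (i/2) cot πx` reduces them to cotangent sums. -/

theorem irrational_fullQuotient {x : ℝ} (hx : Irrational x) (n : ℕ) :
    Irrational (fullQuotient x n) := by
  induction n with
  | zero => exact hx
  | succ n ih =>
    rw [fullQuotient, one_div]
    exact (ih.sub_intCast _).inv

theorem one_lt_fullQuotient_succ {x : ℝ} (hx : Irrational x) (n : ℕ) :
    1 < fullQuotient x (n + 1) := by
  rw [fullQuotient, ← Int.fract]
  have h0 : 0 < Int.fract (fullQuotient x n) :=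
    Int.fract_pos.2 ((irrational_fullQuotient hx n).ne_int _)
  exact (one_lt_div h0).2 (Int.fract_lt_one _)

theorem one_le_partialQuotient_succ {x : ℝ} (hx : Irrational x) (n : ℕ) :
    1 ≤ partialQuotient x (n + 1) :=
  Int.le_floor.2 (by exact_mod_cast (one_lt_fullQuotient_succ hx n).le)

theorem fullQuotient_sub_partialQuotient (x : ℝ) (n : ℕ) :
    fullQuotient x n - partialQuotient x n = (fullQuotient x (n + 1))⁻¹ := by
  rw [fullQuotient, partialQuotient, one_div, inv_inv]

/-- The distance `|qₙ x - pₙ|` from `qₙ x` to the numerator of the `n`-th convergent. -/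
noncomputable def gap (x : ℝ) : ℕ → ℝ
  | 0 => x - partialQuotient x 0
  | n + 1 => gap x n / fullQuotient x (n + 2)

theorem gap_pos {x : ℝ} (hx : Irrational x) (n : ℕ) : 0 < gap x n := by
  induction n with
  | zero => exact Int.fract_pos.2 (hx.ne_int _)
  | succ n ih => exact div_pos ih (one_pos.trans (one_lt_fullQuotient_succ hx _))

theorem gap_succ_lt {x : ℝ} (hx : Irrational x) (n : ℕ) : gap x (n + 1) < gap x n :=
  div_lt_self (gap_pos hx n) (one_lt_fullQuotient_succ hx _)

theorem gap_one {x : ℝ} (hx : Irrational x) :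
    gap x 1 = 1 - partialQuotient x 1 * gap x 0 := by
  have h0 : gap x 0 = (fullQuotient x 1)⁻¹ := fullQuotient_sub_partialQuotient x 0
  have h1 : gap x 1 = gap x 0 * (fullQuotient x 2)⁻¹ := div_eq_mul_inv _ _
  have := one_lt_fullQuotient_succ hx 0
  rw [h1, ← fullQuotient_sub_partialQuotient, h0]
  simp only [zero_add] at this
  field_simp

/-- Subtracting the integer part of a full quotient leaves the inverse of the next one. The gaps
thus obey the recurrence of the denominators with the sign reversed, because `qₙx - pₙ` alternates
in sign. -/
theorem gap_add_two {x : ℝ} (hx : Irrational x) (n : ℕ) :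
    gap x (n + 2) = gap x n - partialQuotient x (n + 2) * gap x (n + 1) := by
  have h1 : gap x (n + 2) = gap x (n + 1) * (fullQuotient x (n + 2 + 1))⁻¹ := div_eq_mul_inv _ _
  have h2 : gap x (n + 1) = gap x n / fullQuotient x (n + 2) := rfl
  have := one_lt_fullQuotient_succ hx (n + 1)
  rw [h1, ← fullQuotient_sub_partialQuotient, h2]
  field_simp

theorem quasiperiod_one {x : ℝ} (hx : Irrational x) :
    (quasiperiod x 1 : ℤ) = partialQuotient x 1 :=
  Int.toNat_of_nonneg (zero_le_one.trans (one_le_partialQuotient_succ hx 0))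

theorem quasiperiod_add_two {x : ℝ} (hx : Irrational x) (n : ℕ) :
    (quasiperiod x (n + 2) : ℤ) =
      partialQuotient x (n + 2) * quasiperiod x (n + 1) + quasiperiod x n := by
  rw [quasiperiod, Nat.cast_add, Nat.cast_mul,
    Int.toNat_of_nonneg (zero_le_one.trans (one_le_partialQuotient_succ hx _))]

theorem quasiperiod_pos {x : ℝ} (hx : Irrational x) (n : ℕ) : 0 < quasiperiod x n := by
  induction n using Nat.twoStepInduction with
  | zero => exact one_pos
  | one =>
    have := quasiperiod_one hx
    have := one_le_partialQuotient_succ hx 0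
    simp only [zero_add] at this
    omega
  | more n h _ => exact Nat.add_pos_right _ h

theorem quasiperiod_add_le {x : ℝ} (hx : Irrational x) (n : ℕ) :
    quasiperiod x (n + 1) + quasiperiod x n ≤ quasiperiod x (n + 2) := by
  have h := quasiperiod_add_two hx n
  have := one_le_partialQuotient_succ hx (n + 1)
  have h2 : (0 : ℤ) ≤ quasiperiod x (n + 1) := Int.natCast_nonneg _
  zify
  nlinarith

theorem quasiperiod_le_succ {x : ℝ} (hx : Irrational x) (n : ℕ) :
    quasiperiod x n ≤ quasiperiod x (n + 1) := by
  cases n with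
  | zero => exact quasiperiod_pos hx 1
  | succ n => exact (Nat.le_add_right _ _).trans (quasiperiod_add_le hx n)

theorem le_quasiperiod {x : ℝ} (hx : Irrational x) (n : ℕ) : n ≤ quasiperiod x n := by
  induction n using Nat.twoStepInduction with
  | zero => exact Nat.zero_le _
  | one => exact quasiperiod_pos hx 1
  | more n _ h =>
    have := quasiperiod_add_le hx n
    have := quasiperiod_pos hx n
    omega

/-- The two recurrences, with opposite signs, leave this determinant-like expression invariant. It
pins `gap x n` to the order of `1/qₙ₊₁`. -/
theorem quasiperiod_mul_gap {x : ℝ} (hx : Irrational x) (n : ℕ) :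
    quasiperiod x (n + 1) * gap x n + quasiperiod x n * gap x (n + 1) = 1 := by
  induction n with
  | zero =>
    have h : (quasiperiod x 1 : ℝ) = partialQuotient x 1 := by exact_mod_cast quasiperiod_one hx
    rw [zero_add, h, gap_one hx, quasiperiod]
    push_cast
    ring
  | succ n ih =>
    have h : (quasiperiod x (n + 2) : ℝ) =
        partialQuotient x (n + 2) * quasiperiod x (n + 1) + quasiperiod x n := by
      exact_mod_cast quasiperiod_add_two hx n
    rw [show n + 1 + 1 = n + 2 from rfl, h, gap_add_two hx, ← ih]
    ring

/-- Two consecutive convergents form a basis of the integer lattice. -/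
theorem exists_convergent_coordinates {x : ℝ} (hx : Irrational x) (n : ℕ) (r s : ℤ) :
    ∃ u v : ℤ, r = u * quasiperiod x n + v * quasiperiod x (n + 1) ∧
      r * x - s = (-1) ^ n * (u * gap x n - v * gap x (n + 1)) := by
  induction n with
  | zero =>
    refine ⟨r - (s - r * partialQuotient x 0) * partialQuotient x 1,
      s - r * partialQuotient x 0, ?_, ?_⟩
    · rw [zero_add, quasiperiod_one hx, quasiperiod]
      push_cast
      ring
    · rw [zero_add, gap_one hx, gap]
      push_cast
      ring
  | succ n ih =>
    obtain ⟨u, v, h1, h2⟩ := ih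
    refine ⟨v - partialQuotient x (n + 2) * u, u, ?_, ?_⟩
    · rw [show n + 1 + 1 = n + 2 from rfl, quasiperiod_add_two hx, h1]
      ring
    · rw [show n + 1 + 1 = n + 2 from rfl, gap_add_two hx, h2]
      push_cast
      ring

theorem exists_abs_quasiperiod_mul_sub {x : ℝ} (hx : Irrational x) (n : ℕ) :
    ∃ p : ℤ, |quasiperiod x n * x - p| = gap x n := by
  suffices h : ∃ p : ℤ, quasiperiod x n * x - p = (-1) ^ n * gap x n by
    obtain ⟨p, hp⟩ := h
    exact ⟨p, by rw [hp, abs_mul, abs_pow, abs_neg, abs_one, one_pow, one_mul,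
      abs_of_pos (gap_pos hx n)]⟩
  induction n using Nat.twoStepInduction with
  | zero => exact ⟨partialQuotient x 0, by simp [quasiperiod, gap]⟩
  | one =>
    refine ⟨partialQuotient x 1 * partialQuotient x 0 + 1, ?_⟩
    have h : (quasiperiod x 1 : ℝ) = partialQuotient x 1 := by exact_mod_cast quasiperiod_one hx
    rw [h, gap_one hx, gap]
    push_cast
    ring
  | more n h0 h1 =>
    obtain ⟨p, hp⟩ := h0
    obtain ⟨p', hp'⟩ := h1
    refine ⟨partialQuotient x (n + 2) * p' + p, ?_⟩
    have h : (quasiperiod x (n + 2) : ℝ) =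
        partialQuotient x (n + 2) * quasiperiod x (n + 1) + quasiperiod x n := by
      exact_mod_cast quasiperiod_add_two hx n
    rw [h, gap_add_two hx]
    push_cast
    linear_combination hp + partialQuotient x (n + 2) * hp'

theorem gap_le_inv {x : ℝ} (hx : Irrational x) (n : ℕ) :
    gap x n ≤ (quasiperiod x n : ℝ)⁻¹ := by
  have h := quasiperiod_mul_gap hx n
  have h1 : (0 : ℝ) < quasiperiod x n := by exact_mod_cast quasiperiod_pos hx n
  have h2 : (quasiperiod x n : ℝ) ≤ quasiperiod x (n + 1) := by
    exact_mod_cast quasiperiod_le_succ hx n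
  rw [← one_div, le_div_iff₀ h1]
  nlinarith [gap_pos hx n, mul_pos h1 (gap_pos hx (n + 1))]

/-- The convergents are best approximations. -/
theorem gap_le_abs_mul_sub {x : ℝ} (hx : Irrational x) {n : ℕ} {r s : ℤ} (hr : 0 < r)
    (hrn : r < quasiperiod x (n + 1)) : gap x n ≤ |r * x - s| := by
  obtain ⟨u, v, h1, h2⟩ := exists_convergent_coordinates hx n r s
  rw [h2, abs_mul, abs_pow, abs_neg, abs_one, one_pow, one_mul]
  have hq : (0 : ℤ) < quasiperiod x n := by exact_mod_cast quasiperiod_pos hx n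
  have hg := gap_pos hx n
  have hg' := gap_pos hx (n + 1)
  -- Since `0 < r < qₙ₊₁`, the coefficients `u` and `v` cannot both be positive or both be
  -- nonpositive. The two terms of `u * gap x n - v * gap x (n + 1)` thus never cancel, and the
  -- first has size at least `gap x n`.
  rcases le_or_gt v 0 with hv | hv
  · have hu : 1 ≤ u := by
      have : 0 < u * quasiperiod x n := by nlinarith
      exact pos_of_mul_pos_left this hq.le
    have hv' : (v : ℝ) ≤ 0 := by exact_mod_cast hv
    have hu' : (1 : ℝ) ≤ u := by exact_mod_cast hu
    exact le_trans (by nlinarith) (le_abs_self _)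
  · have hu : u ≤ -1 := by
      have : u * quasiperiod x n < 0 := by nlinarith
      by_contra! hc
      have : 0 ≤ u := by omega
      nlinarith [mul_nonneg this hq.le]
    have hv' : (0 : ℝ) < v := by exact_mod_cast hv
    have hu' : (u : ℝ) ≤ -1 := by exact_mod_cast hu
    exact le_trans (by nlinarith) (neg_le_abs _)

/-- Numbers of constant type are badly approximable. -/
theorem IsConstantType.exists_le_abs_mul_sub {x : ℝ} (hx : IsConstantType x) :
    ∃ c : ℝ, 0 < c ∧ ∀ r s : ℤ, 0 < r → c / r ≤ |r * x - s| := by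
  obtain ⟨hx, A, hA⟩ := hx
  have hA1 : (1 : ℝ) ≤ A := by exact_mod_cast (one_le_partialQuotient_succ hx 0).trans (hA 1)
  refine ⟨(2 * (A + 1))⁻¹, by positivity, fun r s hr ↦ ?_⟩
  have hex : ∃ n, r < quasiperiod x n :=
    ⟨r.toNat + 1, by have := le_quasiperiod hx (r.toNat + 1); omega⟩
  classical
  obtain ⟨n, hn⟩ : ∃ n, Nat.find hex = n + 1 := by
    refine Nat.exists_eq_succ_of_ne_zero fun h ↦ ?_
    have := Nat.find_spec hex
    rw [h, quasiperiod] at this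
    push_cast at this
    omega
  -- The index is chosen so that `qₙ ≤ r < qₙ₊₁`. Boundedness of the partial quotients then gives
  -- `qₙ₊₁ ≤ (A + 1)r`.
  have h1 : r < quasiperiod x (n + 1) := hn ▸ Nat.find_spec hex
  have h2 : (quasiperiod x n : ℤ) ≤ r := not_lt.1 (Nat.find_min hex (by omega))
  refine le_trans ?_ (gap_le_abs_mul_sub hx hr h1)
  have hq : (0 : ℝ) < quasiperiod x n := by exact_mod_cast quasiperiod_pos hx n
  have h2' : (quasiperiod x n : ℝ) ≤ r := by exact_mod_cast h2
  have h3 : (quasiperiod x (n + 1) : ℝ) ≤ (A + 1) * quasiperiod x n := by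
    cases n with
    | zero =>
      have : (quasiperiod x 1 : ℝ) = partialQuotient x 1 := by exact_mod_cast quasiperiod_one hx
      have h' : (partialQuotient x 1 : ℝ) ≤ A := by exact_mod_cast hA 1
      rw [zero_add, this, quasiperiod]
      push_cast
      linarith
    | succ n =>
      have h : (quasiperiod x (n + 2) : ℝ) =
          partialQuotient x (n + 2) * quasiperiod x (n + 1) + quasiperiod x n := by
        exact_mod_cast quasiperiod_add_two hx n
      have h' : (partialQuotient x (n + 2) : ℝ) ≤ A := by exact_mod_cast hA _
      have h'' : (quasiperiod x n : ℝ) ≤ quasiperiod x (n + 1) := by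
        exact_mod_cast quasiperiod_le_succ hx n
      rw [show n + 1 + 1 = n + 2 from rfl, h]
      nlinarith
  have h4 := quasiperiod_mul_gap hx n
  have h5 := gap_succ_lt hx n
  have h6 : (quasiperiod x n : ℝ) ≤ quasiperiod x (n + 1) := by
    exact_mod_cast quasiperiod_le_succ hx n
  have hg := gap_pos hx n
  have h7 : 1 ≤ gap x n * (2 * (A + 1) * r) :=
    calc (1 : ℝ) ≤ gap x n * (2 * quasiperiod x (n + 1)) := by nlinarith
      _ ≤ gap x n * (2 * ((A + 1) * r)) := by gcongr; exact h3.trans (by gcongr)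
      _ = gap x n * (2 * (A + 1) * r) := by ring
  have hr' : (0 : ℝ) < r := by exact_mod_cast hr
  rwa [inv_eq_one_div, div_div, div_le_iff₀ (by positivity)]

/-! ### Sums of cotangents -/

theorem abs_sin_pi_mul_sub_int (x : ℝ) (p : ℤ) :
    |Real.sin (Real.pi * (x - p))| = |Real.sin (Real.pi * x)| := by
  rw [mul_sub, mul_comm _ (p : ℝ), Real.sin_sub_int_mul_pi, abs_mul]
  simp

theorem two_mul_abs_sub_round_le_abs_sin (x : ℝ) :
    2 * |x - round x| ≤ |Real.sin (Real.pi * x)| := by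
  rw [← abs_sin_pi_mul_sub_int x (round x)]
  have h : |Real.pi * (x - round x)| ≤ Real.pi / 2 := by
    rw [abs_mul, abs_of_pos Real.pi_pos]
    nlinarith [abs_sub_round x, Real.pi_pos]
  convert Real.mul_abs_le_abs_sin h using 1
  rw [abs_mul, abs_of_pos Real.pi_pos]
  field_simp

theorem abs_sin_pi_mul_le (x : ℝ) (p : ℤ) :
    |Real.sin (Real.pi * x)| ≤ Real.pi * |x - p| := by
  rw [← abs_sin_pi_mul_sub_int x p, ← abs_of_pos Real.pi_pos, ← abs_mul, abs_of_pos Real.pi_pos]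
  exact Real.abs_sin_le_abs

theorem sin_pi_mul_ne_zero {x : ℝ} (hx : Irrational x) : Real.sin (Real.pi * x) ≠ 0 := by
  have h := two_mul_abs_sub_round_le_abs_sin x
  have := abs_pos.2 (hx.sub_intCast (round x)).ne_zero
  exact abs_pos.1 (by linarith)

/-- The difference is `sin(b - a)/(sin a sin b)`. The inequality of arithmetic and geometric means
separates `a` from `b`, so each can be summed on its own. -/
theorem abs_cot_sub_cot_le {a b : ℝ} (ha : Real.sin a ≠ 0) (hb : Real.sin b ≠ 0) :
    |Real.cot a - Real.cot b| ≤
      |Real.sin (b - a)| * (((Real.sin a ^ 2)⁻¹ + (Real.sin b ^ 2)⁻¹) / 2) := by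
  have h : Real.cot a - Real.cot b = Real.sin (b - a) * ((Real.sin a)⁻¹ * (Real.sin b)⁻¹) := by
    rw [Real.cot_eq_cos_div_sin, Real.cot_eq_cos_div_sin, Real.sin_sub]
    field_simp
  rw [h, abs_mul]
  refine mul_le_mul_of_nonneg_left ?_ (abs_nonneg _)
  rw [← inv_pow, ← inv_pow, abs_le]
  constructor <;>
    nlinarith [sq_nonneg ((Real.sin a)⁻¹ - (Real.sin b)⁻¹),
      sq_nonneg ((Real.sin a)⁻¹ + (Real.sin b)⁻¹)]

/-- The sum of the inverse squares of finitely many `η`-separated real numbers of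
absolute value at least `η`. -/
theorem sum_inv_sq_le_of_separated {ι : Type*} (s : Finset ι) (y : ι → ℝ) {η : ℝ} (hη : 0 < η)
    (h0 : ∀ i ∈ s, η ≤ |y i|) (h : ∀ i ∈ s, ∀ j ∈ s, i ≠ j → η ≤ |y i - y j|) :
    ∑ i ∈ s, (y i ^ 2)⁻¹ ≤ 4 / η ^ 2 * ∑' k : ℤ, 1 / (k : ℝ) ^ 2 := by
  classical
  have hfl : ∀ i, ⌊y i / η⌋ * η ≤ y i ∧ y i < (⌊y i / η⌋ + 1) * η := fun i ↦
    ⟨(le_div_iff₀ hη).1 (Int.floor_le _), (div_lt_iff₀ hη).1 (Int.lt_floor_add_one _)⟩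
  have hinj : Set.InjOn (fun i ↦ ⌊y i / η⌋) s := by
    intro i hi j hj hij
    by_contra hne
    have h1 := hfl i
    have h2 := hfl j
    simp only at hij
    rw [← hij] at h2
    refine (h i hi j hj hne).not_gt (abs_lt.2 ⟨?_, ?_⟩) <;> nlinarith
  have hle : ∀ i ∈ s, (y i ^ 2)⁻¹ ≤ 4 / η ^ 2 * (1 / (⌊y i / η⌋ : ℝ) ^ 2) := by
    intro i hi
    obtain ⟨h1, h2⟩ := hfl i
    have h3 := h0 i hi
    set k := ⌊y i / η⌋
    have hk : k ≠ 0 := by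
      rintro hk
      rw [hk] at h1 h2
      push_cast at h1 h2
      rw [abs_of_nonneg (by linarith)] at h3
      linarith
    -- The factor 2 is for `k ≤ -2`, where the floor rounds away from zero and only `|y| ≥ (|k| -
    -- 1)η ≥ |k|η/2` is available. The case `k = -1` uses `η ≤ |y|`.
    have h4 : |(k : ℝ)| * η ≤ 2 * |y i| := by
      rcases lt_or_gt_of_ne hk with hk | hk
      · rcases (show k = -1 ∨ k ≤ -2 by omega) with hk | hk
        · rw [hk]
          push_cast
          rw [abs_neg, abs_one]
          linarith
        · have hk' : (k : ℝ) ≤ -2 := by exact_mod_cast hk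
          rw [abs_of_neg (by linarith : (k : ℝ) < 0)]
          nlinarith [neg_le_abs (y i)]
      · have hk' : (0 : ℝ) < k := by exact_mod_cast hk
        rw [abs_of_pos hk']
        nlinarith [le_abs_self (y i)]
    have hk' : (k : ℝ) ≠ 0 := by exact_mod_cast hk
    have h5 : (|(k : ℝ)| * η) ^ 2 ≤ (2 * |y i|) ^ 2 := by gcongr
    rw [mul_pow, mul_pow, sq_abs, sq_abs] at h5
    have hy : 0 < y i ^ 2 := by
      rw [← sq_abs]
      exact pow_pos (hη.trans_le h3) 2
    rw [inv_eq_one_div, div_mul_div_comm, mul_one, div_le_div_iff₀ hy (by positivity)]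
    linarith
  calc ∑ i ∈ s, (y i ^ 2)⁻¹ ≤ ∑ i ∈ s, 4 / η ^ 2 * (1 / (⌊y i / η⌋ : ℝ) ^ 2) :=
        Finset.sum_le_sum hle
    _ = 4 / η ^ 2 * ∑ k ∈ s.image (fun i ↦ ⌊y i / η⌋), 1 / (k : ℝ) ^ 2 := by
        rw [← Finset.mul_sum, Finset.sum_image hinj]
    _ ≤ _ := by
        gcongr
        exact (Real.summable_one_div_int_pow.2 one_lt_two).sum_le_tsum _ fun _ _ ↦ by positivity

/-- Modulo 1, differences of the points `rα` are again multiples of `α` with multiplier below `N`.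
The signed residues are therefore `c/N`-separated and at least `c/N` in size. -/
theorem exists_sum_inv_sin_sq_le {α c : ℝ} (hc : 0 < c)
    (hα : ∀ r s : ℤ, 0 < r → c / r ≤ |r * α - s|) :
    ∃ K : ℝ, 0 ≤ K ∧ ∀ N : ℕ,
      ∑ r ∈ Finset.Icc 1 N, (Real.sin (Real.pi * (r * α)) ^ 2)⁻¹ ≤ K * N ^ 2 := by
  refine ⟨4 / c ^ 2 * ∑' k : ℤ, 1 / (k : ℝ) ^ 2,
    mul_nonneg (by positivity) (tsum_nonneg fun _ ↦ by positivity), fun N ↦ ?_⟩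
  rcases Nat.eq_zero_or_pos N with rfl | hN
  · simp
  have hN' : (0 : ℝ) < N := by exact_mod_cast hN
  have hlow : ∀ r s : ℤ, 0 < r → r ≤ N → c / N ≤ |r * α - s| := fun r s hr hrN ↦ by
    refine le_trans ?_ (hα r s hr)
    have h1 : (0 : ℝ) < r := by exact_mod_cast hr
    have h2 : (r : ℝ) ≤ N := by exact_mod_cast hrN
    gcongr
  have hlt : ∀ i j : ℕ, i < j → j ≤ N →
      c / N ≤ |(j * α - round (j * α)) - (i * α - round (i * α))| := fun i j hij hj ↦ by
    have := hlow ((j : ℤ) - i) (round (j * α) - round (i * α)) (by omega) (by omega)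
    convert this using 2
    push_cast
    ring
  have hmain := sum_inv_sq_le_of_separated (Finset.Icc 1 N)
    (fun r : ℕ ↦ r * α - round (r * α)) (div_pos hc hN')
    (fun r hr ↦ by
      rw [Finset.mem_Icc] at hr
      exact_mod_cast hlow r (round (r * α)) (by omega) (by omega))
    (fun i hi j hj hij ↦ by
      rw [Finset.mem_Icc] at hi hj
      rcases lt_or_gt_of_ne hij with h | h
      · rw [abs_sub_comm]
        exact hlt i j h hj.2
      · exact hlt j i h hi.2)
  calc ∑ r ∈ Finset.Icc 1 N, (Real.sin (Real.pi * (r * α)) ^ 2)⁻¹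
      ≤ ∑ r ∈ Finset.Icc 1 N, (((r : ℝ) * α - round (r * α)) ^ 2)⁻¹ := by
        refine Finset.sum_le_sum fun r hr ↦ ?_
        rw [Finset.mem_Icc] at hr
        have h1 : c / N ≤ |(r : ℝ) * α - round (r * α)| := by
          exact_mod_cast hlow r (round (r * α)) (by omega) (by omega)
        have h2 : 0 < |(r : ℝ) * α - round (r * α)| := (div_pos hc hN').trans_le h1
        have h3 := two_mul_abs_sub_round_le_abs_sin (r * α)
        exact inv_anti₀ (sq_pos_of_ne_zero (abs_pos.1 h2)) (sq_le_sq.2 (by linarith))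
    _ ≤ _ := hmain
    _ = _ := by
        field_simp

theorem sum_inv_sin_sq_subset_le {α K : ℝ} {N : ℕ} (s : Finset ℕ) (g : ℕ → ℕ)
    (hg : Set.InjOn g s) (hs : ∀ r ∈ s, g r ∈ Finset.Icc 1 N)
    (hK : ∑ r ∈ Finset.Icc 1 N, (Real.sin (Real.pi * (r * α)) ^ 2)⁻¹ ≤ K) :
    ∑ r ∈ s, (Real.sin (Real.pi * (g r * α)) ^ 2)⁻¹ ≤ K := by
  classical
  refine le_trans ?_ hK
  rw [← Finset.sum_image (f := fun r : ℕ ↦ (Real.sin (Real.pi * (r * α)) ^ 2)⁻¹) hg]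
  exact Finset.sum_le_sum_of_subset_of_nonneg (Finset.image_subset_iff.2 hs)
    fun _ _ _ ↦ by positivity

/-- The cotangent sum along a rotation of constant type grows at most linearly. -/
theorem exists_abs_sum_cot_le {α : ℝ} (hα : IsConstantType α) :
    ∃ K : ℝ, ∀ N : ℕ, |∑ r ∈ Finset.Icc 1 N, Real.cot (Real.pi * (r * α))| ≤ K * N := by
  obtain ⟨c, hc, hbad⟩ := hα.exists_le_abs_mul_sub
  obtain ⟨S, hS0, hS⟩ := exists_sum_inv_sin_sq_le hc hbad
  have hsin : ∀ r : ℕ, 0 < r → Real.sin (Real.pi * (r * α)) ≠ 0 := fun r hr ↦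
    sin_pi_mul_ne_zero (hα.1.natCast_mul hr.ne')
  -- Per unit of `Q`, `2πS/c` pays for the two comparisons and `1/c` for the term at `Q`; the last
  -- `1/c` is slack.
  refine ⟨(2 * Real.pi * S + 1) / c + 1 / c, fun N ↦ ?_⟩
  induction N using Nat.strong_induction_on with
  | _ N ih =>
  rcases Nat.eq_zero_or_pos N with rfl | hN
  · simp
  have hN' : (0 : ℝ) < N := by exact_mod_cast hN
  obtain ⟨Q, hQ0, hQN, hQ⟩ := Real.exists_nat_abs_mul_sub_round_le α hN
  have hQ0' : (0 : ℝ) < Q := by exact_mod_cast hQ0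
  have hlow := hbad Q (round (Q * α)) (by exact_mod_cast hQ0)
  push_cast at hlow
  have hQN1 : |(Q : ℝ) * α - round (Q * α)| ≤ 1 / N :=
    hQ.trans (one_div_le_one_div_of_le hN' (by linarith))
  have hNQ : (N : ℝ) ≤ Q / c := by
    have := hlow.trans hQN1
    rw [div_le_div_iff₀ hQ0' hN'] at this
    rw [le_div_iff₀ hc]
    linarith
  have hsQ : |Real.sin (Real.pi * (Q * α))| ≤ Real.pi / N := by
    refine (abs_sin_pi_mul_le _ (round (Q * α))).trans ?_
    rw [div_eq_mul_one_div]
    gcongr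
  set f : ℕ → ℝ := fun r ↦ Real.cot (Real.pi * (r * α))
  -- Comparing cotangents at points `Qα` apart costs at most `π/N` times `S * N ^ 2`.
  have herr : ∀ (s : Finset ℕ) (g h : ℕ → ℕ), Set.InjOn g s → Set.InjOn h s →
      (∀ r ∈ s, g r ∈ Finset.Icc 1 N) → (∀ r ∈ s, h r ∈ Finset.Icc 1 N) →
      ∑ r ∈ s, |Real.sin (Real.pi * (Q * α))| *
        (((Real.sin (Real.pi * (g r * α)) ^ 2)⁻¹ + (Real.sin (Real.pi * (h r * α)) ^ 2)⁻¹) / 2)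
        ≤ Real.pi * S * N := by
    intro s g h hg hh hgs hhs
    rw [← Finset.mul_sum, ← Finset.sum_div, Finset.sum_add_distrib]
    have h1 := sum_inv_sin_sq_subset_le s g hg hgs (hS N)
    have h2 := sum_inv_sin_sq_subset_le s h hh hhs (hS N)
    calc _ ≤ Real.pi / N * ((S * N ^ 2 + S * N ^ 2) / 2) := by gcongr
      _ = Real.pi * S * N := by field_simp; ring
  -- the part before `Q`, by reflection
  have hA : |∑ r ∈ Finset.Icc 1 (Q - 1), f r| ≤ Real.pi * S * N := by
    have hrefl : ∑ r ∈ Finset.Icc 1 (Q - 1), f (Q - r) = ∑ r ∈ Finset.Icc 1 (Q - 1), f r := by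
      have hmem : ∀ r ∈ Finset.Icc 1 (Q - 1), Q - r ∈ Finset.Icc 1 (Q - 1) := by
        simp only [Finset.mem_Icc]
        omega
      have hinv : ∀ r ∈ Finset.Icc 1 (Q - 1), Q - (Q - r) = r := by
        simp only [Finset.mem_Icc]
        omega
      exact Finset.sum_bij' (fun r _ ↦ Q - r) (fun r _ ↦ Q - r) hmem hmem hinv hinv
        fun _ _ ↦ rfl
    -- As `cot` is odd, each summand is a difference of cotangents at arguments `πQα` apart. By
    -- `hrefl` the whole is twice the wanted sum.
    have hsum : |∑ r ∈ Finset.Icc 1 (Q - 1), (f r + f (Q - r))| ≤ Real.pi * S * N := by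
      refine (Finset.abs_sum_le_sum_abs _ _).trans ((Finset.sum_le_sum fun r hr ↦ ?_).trans
        (herr (Finset.Icc 1 (Q - 1)) id (fun r ↦ Q - r) Function.injective_id.injOn ?_ ?_ ?_))
      · rw [Finset.mem_Icc] at hr
        have hcast : ((Q - r : ℕ) : ℝ) = Q - r := Nat.cast_sub (by omega)
        have h1 := hsin r (by omega)
        have h2 := hsin (Q - r) (by omega)
        have h3 : Real.sin (-(Real.pi * ((Q - r : ℕ) * α))) ≠ 0 := by
          rw [Real.sin_neg]
          exact neg_ne_zero.2 h2
        have h4 := abs_cot_sub_cot_le h3 h1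
        rw [Real.sin_neg, neg_sq, add_comm (_⁻¹)] at h4
        rw [show Real.pi * (r * α) - -(Real.pi * ((Q - r : ℕ) * α)) = Real.pi * (Q * α) by
          rw [hcast]
          ring] at h4
        refine le_of_eq_of_le ?_ h4
        rw [Real.cot_eq_cos_div_sin (-_), Real.cos_neg, Real.sin_neg, div_neg,
          ← Real.cot_eq_cos_div_sin, ← abs_neg]
        congr 1
        ring
      · intro i hi j hj hij
        simp only [Finset.coe_Icc, Set.mem_Icc] at hi hj hij
        omega
      · simp only [Finset.mem_Icc, id]
        omega
      · simp only [Finset.mem_Icc]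
        omega
    rw [Finset.sum_add_distrib, hrefl, ← two_mul, abs_mul, abs_two] at hsum
    linarith [abs_nonneg (∑ r ∈ Finset.Icc 1 (Q - 1), f r)]
  have hB : |f Q| ≤ Q / c := by
    have h1 := two_mul_abs_sub_round_le_abs_sin (Q * α)
    have h2 : c / Q ≤ |Real.sin (Real.pi * (Q * α))| := by
      linarith [abs_nonneg ((Q : ℝ) * α - round (Q * α))]
    change |Real.cot (Real.pi * (Q * α))| ≤ _
    rw [Real.cot_eq_cos_div_sin, abs_div]
    calc _ ≤ 1 / (c / Q) := by
          gcongr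
          exact Real.abs_cos_le_one _
      _ = Q / c := by field_simp
  have hC : |∑ r ∈ Finset.Icc 1 (N - Q), (f (Q + r) - f r)| ≤ Real.pi * S * N := by
    refine (Finset.abs_sum_le_sum_abs _ _).trans ((Finset.sum_le_sum fun r hr ↦ ?_).trans
      (herr (Finset.Icc 1 (N - Q)) id (fun r ↦ Q + r) Function.injective_id.injOn
        (add_right_injective Q).injOn ?_ ?_))
    · rw [Finset.mem_Icc] at hr
      have h4 := abs_cot_sub_cot_le (hsin r (by omega)) (hsin (Q + r) (by omega))
      rw [abs_sub_comm] at h4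
      rwa [show Real.pi * ((Q + r : ℕ) * α) - Real.pi * (r * α) = Real.pi * (Q * α) by
        push_cast
        ring] at h4
    · simp only [Finset.mem_Icc, id]
      omega
    · simp only [Finset.mem_Icc]
      omega
  have hsplit : ∑ r ∈ Finset.Icc 1 N, f r = ∑ r ∈ Finset.Icc 1 (Q - 1), f r + f Q +
      ∑ r ∈ Finset.Icc 1 (N - Q), (f (Q + r) - f r) + ∑ r ∈ Finset.Icc 1 (N - Q), f r := by
    obtain ⟨P, hP⟩ : ∃ P, Q = P + 1 := ⟨Q - 1, by omega⟩
    obtain ⟨m, hm⟩ : ∃ m, N = P + 1 + m := ⟨N - (P + 1), by omega⟩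
    have hm' : N - Q = m := by omega
    have hP' : Q - 1 = P := by omega
    have hIcc : ∀ (k : ℕ) (g : ℕ → ℝ),
        ∑ r ∈ Finset.Icc 1 k, g r = ∑ r ∈ Finset.range k, g (r + 1) := fun k g ↦ by
      rw [Finset.range_eq_Ico, Finset.sum_Ico_add' g 0 k 1]
      rfl
    rw [Finset.sum_sub_distrib, add_assoc _ (_ - _), sub_add_cancel, hm', hP', hm, hP]
    simp only [hIcc, Finset.sum_range_add, Finset.sum_range_one, add_assoc]
  have hD := ih (N - Q) (by omega)
  rw [Nat.cast_sub hQN] at hD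
  rw [hsplit]
  have h5 : 2 * Real.pi * S * N ≤ 2 * Real.pi * S * (Q / c) := by gcongr
  have h6 : |(∑ r ∈ Finset.Icc 1 (Q - 1), f r) + f Q +
      (∑ r ∈ Finset.Icc 1 (N - Q), (f (Q + r) - f r)) + ∑ r ∈ Finset.Icc 1 (N - Q), f r| ≤
      |∑ r ∈ Finset.Icc 1 (Q - 1), f r| + |f Q| +
      |∑ r ∈ Finset.Icc 1 (N - Q), (f (Q + r) - f r)| + |∑ r ∈ Finset.Icc 1 (N - Q), f r| :=
    (abs_add_le _ _).trans (add_le_add_left ((abs_add_le _ _).trans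
      (add_le_add_left (abs_add_le _ _) _)) _)
  have h7 : 2 * Real.pi * S * (Q / c) + Q / c = (2 * Real.pi * S + 1) / c * Q := by ring
  have h8 : 0 ≤ 1 / c * Q := by positivity
  nlinarith

/-! ### Partial summation -/

theorem birkhoffS_succ (α : ℝ) (φ : UnitAddCircle → ℂ) (N : ℕ) :
    birkhoffS α φ (N + 1) =
      birkhoffS α φ N + φ ((((N + 1 : ℕ) : ℝ) * α : ℝ) : UnitAddCircle) :=
  Finset.sum_Icc_succ_top (Nat.le_add_left 1 N) _

/-- Abel summation by induction: replacing the weight at `N` by the weight at `N + 1` costs `C‖Mα‖ ·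
BN`, and these costs add up to the triangular number. -/
theorem norm_birkhoffS_mul_sub_le {α B : ℝ} {C : ℝ≥0} {ψ φ : UnitAddCircle → ℂ}
    (hψ : LipschitzWith C ψ) (hφ : ∀ N : ℕ, ‖birkhoffS α φ N‖ ≤ B * N) (M : ℤ) (N : ℕ) :
    ‖birkhoffS α (fun x ↦ ψ (M • x) * φ x) N -
        ψ (M • ((N * α : ℝ) : UnitAddCircle)) * birkhoffS α φ N‖ ≤
      B * C * ‖((M * α : ℝ) : UnitAddCircle)‖ * (N * (N - 1) / 2) := by
  induction N with
  | zero => simp [birkhoffS]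
  | succ N ih =>
    have hstep : M • ((N * α : ℝ) : UnitAddCircle) -
        M • ((((N + 1 : ℕ) : ℝ) * α : ℝ) : UnitAddCircle) = -((M * α : ℝ) : UnitAddCircle) := by
      rw [← AddCircle.coe_zsmul, ← AddCircle.coe_zsmul, ← AddCircle.coe_sub, ← AddCircle.coe_neg]
      congr 1
      push_cast
      simp only [zsmul_eq_mul]
      ring
    have hL : ‖ψ (M • ((N * α : ℝ) : UnitAddCircle)) -
        ψ (M • ((((N + 1 : ℕ) : ℝ) * α : ℝ) : UnitAddCircle))‖ ≤
        C * ‖((M * α : ℝ) : UnitAddCircle)‖ := by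
      rw [← norm_neg ((M * α : ℝ) : UnitAddCircle), ← hstep, ← dist_eq_norm, ← dist_eq_norm]
      exact hψ.dist_le_mul _ _
    rw [birkhoffS_succ, birkhoffS_succ]
    set u := ψ (M • ((N * α : ℝ) : UnitAddCircle))
    set v := ψ (M • ((((N + 1 : ℕ) : ℝ) * α : ℝ) : UnitAddCircle))
    calc _ = ‖(birkhoffS α (fun x ↦ ψ (M • x) * φ x) N - u * birkhoffS α φ N) +
          (u - v) * birkhoffS α φ N‖ := by congr 1; ring
      _ ≤ B * C * ‖((M * α : ℝ) : UnitAddCircle)‖ * (N * (N - 1) / 2) +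
          C * ‖((M * α : ℝ) : UnitAddCircle)‖ * (B * N) := by
        refine (norm_add_le _ _).trans (add_le_add ih ?_)
        rw [norm_mul]
        exact mul_le_mul hL (hφ N) (norm_nonneg _) (by positivity)
      _ = _ := by
        push_cast
        ring

/-- Partial Birkhoff summation. -/
theorem norm_birkhoffS_mul_le {α B S : ℝ} {C : ℝ≥0} {ψ φ : UnitAddCircle → ℂ}
    (hψ : LipschitzWith C ψ) (hS : ∀ x, ‖ψ x‖ ≤ S)
    (hφ : ∀ N : ℕ, ‖birkhoffS α φ N‖ ≤ B * N) (M : ℤ) (N : ℕ) :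
    ‖birkhoffS α (fun x ↦ ψ (M • x) * φ x) N‖ ≤
      B * N * (1 / 2 * C * ‖((M * α : ℝ) : UnitAddCircle)‖ * ((N : ℝ) - 1) + S) := by
  have h1 := norm_birkhoffS_mul_sub_le hψ hφ M N
  have h2 : ‖ψ (M • ((N * α : ℝ) : UnitAddCircle)) * birkhoffS α φ N‖ ≤ S * (B * N) := by
    rw [norm_mul]
    exact mul_le_mul (hS _) (hφ N) (norm_nonneg _) ((norm_nonneg _).trans (hS 0))
  have h3 := norm_sub_norm_le (birkhoffS α (fun x ↦ ψ (M • x) * φ x) N)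
    (ψ (M • ((N * α : ℝ) : UnitAddCircle)) * birkhoffS α φ N)
  linarith

/-! ### The observables -/

theorem e_coe (x : ℝ) : e (x : UnitAddCircle) = Complex.exp (2 * Real.pi * Complex.I * x) :=
  periodic_e.lift_coe x

theorem cotPi_coe (x : ℝ) : cotPi (x : UnitAddCircle) = Real.cot (Real.pi * x) :=
  periodic_cotPi.lift_coe x

theorem signedCoord_coe (x : ℝ) : signedCoord (x : UnitAddCircle) = signedFract x :=
  periodic_signedFract.lift_coe x

theorem e_coe_eq_exp_I_mul (x : ℝ) :
    e (x : UnitAddCircle) = Complex.exp (Complex.I * (2 * Real.pi * x : ℝ)) := by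
  rw [e_coe]
  congr 1
  push_cast
  ring

theorem norm_e (x : UnitAddCircle) : ‖e x‖ = 1 := by
  induction x using QuotientAddGroup.induction_on with
  | H x => exact (congrArg _ (e_coe_eq_exp_I_mul x)).trans (Complex.norm_exp_I_mul_ofReal _)

theorem lipschitzWith_e : LipschitzWith (2 * NNReal.pi) e := by
  refine LipschitzWith.of_dist_le_mul fun x y ↦ ?_
  induction x using QuotientAddGroup.induction_on with | H x => ?_
  induction y using QuotientAddGroup.induction_on with | H y => ?_
  change dist (e (x : UnitAddCircle)) (e (y : UnitAddCircle)) ≤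
    _ * dist (x : UnitAddCircle) (y : UnitAddCircle)
  have h : e (x : UnitAddCircle) - e (y : UnitAddCircle) =
      e (y : UnitAddCircle) * (Complex.exp (Complex.I * (2 * Real.pi * (x - y) : ℝ)) - 1) := by
    rw [e_coe_eq_exp_I_mul, e_coe_eq_exp_I_mul, mul_sub, ← Complex.exp_add, mul_one]
    congr 2
    push_cast
    ring
  rw [dist_eq_norm, dist_eq_norm, h, norm_mul, norm_e, one_mul,
    Complex.norm_exp_I_mul_ofReal_sub_one, ← AddCircle.coe_sub, UnitAddCircle.norm_eq,
    show 2 * Real.pi * (x - y) / 2 = Real.pi * (x - y) by ring, norm_mul, Real.norm_eq_abs,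
    Real.norm_eq_abs, abs_two]
  have := abs_sin_pi_mul_le (x - y) (round (x - y))
  push_cast
  rw [NNReal.coe_real_pi]
  linarith

/-- The poles at `0` cancel: over the common denominator `y sin πy ≥ 2y²`, the numerator `sin πy -
πy cos πy` is at most `(πy)³/2` for `y > 0`. -/
theorem abs_inv_sub_pi_mul_cot_le {y : ℝ} (h0 : y ≠ 0) (h : |y| ≤ 1 / 2) :
    |1 / y - Real.pi * Real.cot (Real.pi * y)| ≤ Real.pi ^ 3 := by
  wlog hy : 0 < y generalizing y
  · have := this (neg_ne_zero.2 h0) (by rwa [abs_neg]) (by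
      rw [neg_pos]
      exact lt_of_le_of_ne (not_lt.1 hy) h0)
    rw [mul_neg, Real.cot_eq_cos_div_sin, Real.cos_neg, Real.sin_neg, div_neg, div_neg, mul_neg,
      ← neg_sub', abs_neg] at this
    rwa [Real.cot_eq_cos_div_sin]
  rw [abs_of_pos hy] at h
  have hpi := Real.pi_pos
  have hlow : 2 * y ≤ Real.sin (Real.pi * y) := by
    have := Real.mul_le_sin (mul_nonneg hpi.le hy.le) (by nlinarith)
    convert this using 1
    field_simp
  have hs : 0 < Real.sin (Real.pi * y) := by linarith
  have hup : Real.sin (Real.pi * y) ≤ Real.pi * y := Real.sin_le (by positivity)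
  have hcos := Real.one_sub_sq_div_two_le_cos (x := Real.pi * y)
  -- This is `t ≤ tan t`, giving the sign of the numerator; `y = 1/2` is separate because the cosine
  -- vanishes there.
  have htan : Real.pi * y * Real.cos (Real.pi * y) ≤ Real.sin (Real.pi * y) := by
    rcases h.lt_or_eq with h | h
    · have hc : 0 < Real.cos (Real.pi * y) := Real.cos_pos_of_mem_Ioo ⟨by nlinarith, by nlinarith⟩
      have := Real.le_tan (mul_nonneg hpi.le hy.le) (by nlinarith)
      rwa [Real.tan_eq_sin_div_cos, le_div_iff₀ hc] at this
    · rw [h, mul_one_div, Real.cos_pi_div_two, Real.sin_pi_div_two, mul_zero]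
      exact zero_le_one
  have heq : 1 / y - Real.pi * Real.cot (Real.pi * y) =
      (Real.sin (Real.pi * y) - Real.pi * y * Real.cos (Real.pi * y)) /
        (y * Real.sin (Real.pi * y)) := by
    have hs' := hs.ne'
    rw [Real.cot_eq_cos_div_sin]
    generalize Real.sin (Real.pi * y) = s at hs' ⊢
    field_simp
  rw [heq, abs_of_nonneg (div_nonneg (by linarith) (by positivity)), div_le_iff₀ (by positivity)]
  have h1 : Real.sin (Real.pi * y) - Real.pi * y * Real.cos (Real.pi * y) ≤
      (Real.pi * y) ^ 3 / 2 := by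
    nlinarith [mul_le_mul_of_nonneg_left hcos (mul_nonneg hpi.le hy.le)]
  have h2 : (Real.pi * y) ^ 3 / 2 ≤ Real.pi ^ 3 * (y * (2 * y)) := by
    have : y ^ 3 / 2 ≤ y * (2 * y) := by nlinarith [mul_pos hy hy]
    calc _ = Real.pi ^ 3 * (y ^ 3 / 2) := by ring
      _ ≤ _ := by gcongr
  calc _ ≤ Real.pi ^ 3 * (y * (2 * y)) := h1.trans h2
    _ ≤ _ := by gcongr

theorem abs_signedFract_le (x : ℝ) : |signedFract x| ≤ 1 / 2 := by
  have h0 := Int.fract_nonneg x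
  have h1 := Int.fract_lt_one x
  rw [signedFract, abs_le]
  split_ifs <;> constructor <;> linarith

theorem exists_signedFract_eq_sub (x : ℝ) : ∃ m : ℤ, signedFract x = x - m := by
  rw [signedFract, Int.fract]
  split_ifs
  · exact ⟨⌊x⌋ + 1, by push_cast; ring⟩
  · exact ⟨⌊x⌋, by ring⟩

theorem abs_inv_signedFract_sub_le {x : ℝ} (hx : Irrational x) :
    |1 / signedFract x - Real.pi * Real.cot (Real.pi * x)| ≤ Real.pi ^ 3 := by
  obtain ⟨m, hm⟩ := exists_signedFract_eq_sub x
  have h0 : signedFract x ≠ 0 := by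
    rw [hm]
    exact (hx.sub_intCast m).ne_zero
  have h := abs_inv_sub_pi_mul_cot_le h0 (abs_signedFract_le x)
  have hcot : Real.cot (Real.pi * signedFract x) = Real.cot (Real.pi * x) := by
    rw [← cotPi_coe, ← cotPi_coe, hm, AddCircle.coe_sub]
    congr 1
    rw [sub_eq_self, AddCircle.coe_eq_zero_iff]
    exact ⟨m, by simp⟩
  rwa [hcot] at h

/-! ### Rotation numbers of constant type -/

theorem exists_norm_birkhoffS_cotPi_le {α : ℝ} (hα : IsConstantType α) :
    ∃ B : ℝ, ∀ N : ℕ, ‖birkhoffS α (fun x ↦ (cotPi x : ℂ)) N‖ ≤ B * N := by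
  obtain ⟨K, hK⟩ := exists_abs_sum_cot_le hα
  refine ⟨K, fun N ↦ ?_⟩
  simp only [birkhoffS, cotPi_coe]
  rw [← Complex.ofReal_sum, Complex.norm_real]
  exact hK N

theorem exists_norm_birkhoffS_inv_signedCoord_le {α : ℝ} (hα : IsConstantType α) :
    ∃ B : ℝ, ∀ N : ℕ, ‖birkhoffS α (fun x ↦ (signedCoord x : ℂ)⁻¹) N‖ ≤ B * N := by
  obtain ⟨K, hK⟩ := exists_abs_sum_cot_le hα
  refine ⟨Real.pi * K + Real.pi ^ 3, fun N ↦ ?_⟩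
  simp only [birkhoffS, signedCoord_coe]
  simp only [← Complex.ofReal_inv]
  rw [← Complex.ofReal_sum, Complex.norm_real, Real.norm_eq_abs]
  have h1 : |∑ r ∈ Finset.Icc 1 N,
      ((signedFract (r * α))⁻¹ - Real.pi * Real.cot (Real.pi * (r * α)))| ≤
      N * Real.pi ^ 3 := by
    refine (Finset.abs_sum_le_sum_abs _ _).trans ((Finset.sum_le_card_nsmul _ _
      (Real.pi ^ 3) fun r hr ↦ ?_).trans_eq ?_)
    · rw [← one_div]
      exact abs_inv_signedFract_sub_le
        (hα.1.natCast_mul (Nat.pos_iff_ne_zero.1 (Finset.mem_Icc.1 hr).1))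
    · rw [Nat.card_Icc, Nat.add_sub_cancel, nsmul_eq_mul]
  rw [Finset.sum_sub_distrib, ← Finset.mul_sum] at h1
  have h2 : |Real.pi * ∑ r ∈ Finset.Icc 1 N, Real.cot (Real.pi * (r * α))| ≤
      Real.pi * (K * N) := by
    rw [abs_mul, abs_of_pos Real.pi_pos]
    gcongr
    exact hK N
  have h3 := abs_sub_abs_le_abs_sub (∑ r ∈ Finset.Icc 1 N, (signedFract (r * α))⁻¹)
    (Real.pi * ∑ r ∈ Finset.Icc 1 N, Real.cot (Real.pi * (r * α)))
  linarith

theorem norm_quasiperiod_mul_le {α : ℝ} (hα : Irrational α) (n : ℕ) :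
    ‖((quasiperiod α n * α : ℝ) : UnitAddCircle)‖ ≤ (quasiperiod α n : ℝ)⁻¹ := by
  obtain ⟨p, hp⟩ := exists_abs_quasiperiod_mul_sub hα n
  rw [UnitAddCircle.norm_eq]
  exact (round_le _ p).trans (hp.le.trans (gap_le_inv hα n))

/-- In partial summation with `M = qₙ`, the Lipschitz constant `2π` and `‖qₙα‖ ≤ 1/qₙ` make the
variation term at most `π`; the supremum of `|e|` adds 1. -/
theorem norm_birkhoffS_e_quasiperiod_mul_le {α B : ℝ} (hα : Irrational α)
    {φ : UnitAddCircle → ℂ} (hφ : ∀ N : ℕ, ‖birkhoffS α φ N‖ ≤ B * N) (n : ℕ) :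
    ‖birkhoffS α (fun x ↦ e (quasiperiod α n • x) * φ x) (quasiperiod α n - 1)‖ ≤
      B * (Real.pi + 1) * quasiperiod α n := by
  have hB : 0 ≤ B := by simpa using (norm_nonneg _).trans (hφ 1)
  have hq := quasiperiod_pos hα n
  have h := norm_birkhoffS_mul_le lipschitzWith_e (fun x ↦ (norm_e x).le) hφ
    (quasiperiod α n) (quasiperiod α n - 1)
  simp only [natCast_zsmul] at h
  refine h.trans ?_
  have hN := norm_quasiperiod_mul_le hα n
  rw [Nat.cast_sub hq]
  push_cast
  rw [NNReal.coe_real_pi]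
  set q := (quasiperiod α n : ℝ)
  have hq1 : (1 : ℝ) ≤ q := Nat.one_le_cast.2 hq
  set d := ‖((q * α : ℝ) : UnitAddCircle)‖
  have hd : 0 ≤ d := norm_nonneg _
  have h1 : d * q ≤ 1 := by
    rwa [← one_div, le_div_iff₀ (by linarith)] at hN
  have h2 : 1 / 2 * (2 * Real.pi) * d * (q - 1 - 1) + 1 ≤ Real.pi + 1 := by
    have : d * (q - 1 - 1) ≤ 1 := by nlinarith
    nlinarith [Real.pi_pos]
  calc _ ≤ B * (q - 1) * (Real.pi + 1) := by
        gcongr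
    _ ≤ B * q * (Real.pi + 1) := by
        have := Real.pi_pos
        gcongr
        linarith
    _ = _ := by ring

/-- This follows from `e(x) - 1 = 2i sin(πx) exp(πix)`, and is what brings cotangents into the
geometric sums. -/
theorem inv_e_sub_one {x : ℝ} (hx : Real.sin (Real.pi * x) ≠ 0) :
    e (x : UnitAddCircle) ≠ 1 ∧ (e (x : UnitAddCircle) - 1)⁻¹ =
      -(1 / 2) - Complex.I / 2 * (Real.cot (Real.pi * x) : ℝ) := by
  have hs : Complex.sin (Real.pi * x) ≠ 0 := by exact_mod_cast hx
  have he : e (x : UnitAddCircle) - 1 = 2 * Complex.I * Complex.sin (Real.pi * x) *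
      (Complex.cos (Real.pi * x) + Complex.sin (Real.pi * x) * Complex.I) := by
    rw [e_coe, show (2 * Real.pi * Complex.I * x : ℂ) = 2 * (Real.pi * x) * Complex.I by ring,
      Complex.exp_mul_I, Complex.cos_two_mul', Complex.sin_two_mul]
    linear_combination Complex.sin_sq_add_cos_sq (Real.pi * x) -
      2 * Complex.sin (Real.pi * x) ^ 2 * Complex.I_sq
  have h1 : (e (x : UnitAddCircle) - 1) *
      (-(1 / 2) - Complex.I / 2 * (Real.cot (Real.pi * x) : ℝ)) = 1 := by
    rw [he, Real.cot_eq_cos_div_sin]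
    push_cast
    field_simp
    linear_combination Complex.sin_sq_add_cos_sq (Real.pi * x) -
      (Complex.sin (Real.pi * x) ^ 2 + Complex.cos (Real.pi * x) ^ 2 +
        Complex.I * Complex.cos (Real.pi * x) * Complex.sin (Real.pi * x)) * Complex.I_sq
  exact ⟨fun h ↦ by simp [h] at h1, inv_eq_of_mul_eq_one_right h1⟩

theorem exp2_eq {α : ℝ} (hα : Irrational α) {q : ℕ} (hq : 0 < q) :
    exp2 α q = q - 1 / 2 * birkhoffS α (fun x ↦ e (q • x)) (q - 1) + 1 / 2 * (q - 1 : ℕ)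
      - Complex.I / 2 * birkhoffS α (fun x ↦ e (q • x) * (cotPi x : ℂ)) (q - 1)
      + Complex.I / 2 * birkhoffS α (fun x ↦ (cotPi x : ℂ)) (q - 1) := by
  have hterm : ∀ u ∈ Finset.Icc 1 (q - 1), ∑ v ∈ Finset.range q,
      Complex.exp (2 * Real.pi * Complex.I * u * v * α) =
      -(1 / 2 * e (q • ((u * α : ℝ) : UnitAddCircle))) + 1 / 2
      - Complex.I / 2 *
        (e (q • ((u * α : ℝ) : UnitAddCircle)) * (cotPi ((u * α : ℝ) : UnitAddCircle) : ℂ))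
      + Complex.I / 2 * (cotPi ((u * α : ℝ) : UnitAddCircle) : ℂ) := by
    intro u hu
    have hu0 : u ≠ 0 := Nat.pos_iff_ne_zero.1 (Finset.mem_Icc.1 hu).1
    obtain ⟨h1, h2⟩ := inv_e_sub_one (sin_pi_mul_ne_zero (hα.natCast_mul hu0))
    have hpow : ∀ v : ℕ, e ((u * α : ℝ) : UnitAddCircle) ^ v =
        Complex.exp (2 * Real.pi * Complex.I * u * v * α) := fun v ↦ by
      rw [e_coe, ← Complex.exp_nat_mul]
      congr 1
      push_cast
      ring
    have hpow' : e (q • ((u * α : ℝ) : UnitAddCircle)) = e ((u * α : ℝ) : UnitAddCircle) ^ q := by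
      rw [hpow, ← AddCircle.coe_nsmul, e_coe]
      congr 1
      rw [nsmul_eq_mul]
      push_cast
      ring
    simp only [← hpow]
    rw [geom_sum_eq h1, div_eq_mul_inv, h2, hpow', cotPi_coe]
    ring
  -- The row `u = 0`, where the geometric ratio is 1, contributes `q`.
  have hsplit : exp2 α q = q + ∑ u ∈ Finset.Icc 1 (q - 1), ∑ v ∈ Finset.range q,
      Complex.exp (2 * Real.pi * Complex.I * u * v * α) := by
    obtain ⟨m, rfl⟩ : ∃ m, q = m + 1 := ⟨q - 1, by omega⟩
    rw [exp2, Finset.range_eq_Ico, Finset.sum_eq_sum_Ico_succ_bot hq, Nat.add_sub_cancel,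
      ← Finset.range_eq_Ico]
    congr 1
    simp
  rw [hsplit, Finset.sum_congr rfl hterm]
  simp only [Finset.sum_add_distrib, Finset.sum_sub_distrib, Finset.sum_neg_distrib,
    ← Finset.mul_sum, Finset.sum_const, Nat.card_Icc, Nat.add_sub_cancel, nsmul_eq_mul, birkhoffS]
  ring

theorem exists_norm_exp2_le {α : ℝ} (hα : IsConstantType α) :
    ∃ K : ℝ, ∀ n : ℕ, ‖exp2 α (quasiperiod α n)‖ ≤ K * quasiperiod α n := by
  obtain ⟨B, hB⟩ := exists_norm_birkhoffS_cotPi_le hα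
  have hB0 : 0 ≤ B := by simpa using (norm_nonneg _).trans (hB 1)
  -- The 2 collects 1 from the row `u = 0` and 1/2 from each of the two sums without cotangents,
  -- which are bounded trivially.
  refine ⟨2 + B * (Real.pi + 1) / 2 + B / 2, fun n ↦ ?_⟩
  have hq := quasiperiod_pos hα.1 n
  have h1 := norm_birkhoffS_e_quasiperiod_mul_le hα.1 hB n
  have h2 := hB (quasiperiod α n - 1)
  rw [exp2_eq hα.1 hq]
  set q := quasiperiod α n
  have hqq : ((q - 1 : ℕ) : ℝ) ≤ q := by exact_mod_cast Nat.sub_le q 1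
  have h3 : ‖birkhoffS α (fun x ↦ e (q • x)) (q - 1)‖ ≤ (q - 1 : ℕ) := by
    refine (norm_sum_le _ _).trans_eq ?_
    simp [norm_e]
  have h4 : B * (q - 1 : ℕ) ≤ B * q := by gcongr
  set S₁ := birkhoffS α (fun x ↦ e (q • x)) (q - 1)
  set S₂ := birkhoffS α (fun x ↦ e (q • x) * (cotPi x : ℂ)) (q - 1)
  set S₃ := birkhoffS α (fun x ↦ (cotPi x : ℂ)) (q - 1)
  have hI : ‖Complex.I / 2‖ = 1 / 2 := by simp
  have hh : ‖(1 / 2 : ℂ)‖ = 1 / 2 := by simp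
  calc _ ≤ ‖(q : ℂ)‖ + ‖1 / 2 * S₁‖ + ‖(1 / 2 : ℂ) * (q - 1 : ℕ)‖ + ‖Complex.I / 2 * S₂‖ +
        ‖Complex.I / 2 * S₃‖ := by
        refine (norm_add_le _ _).trans (add_le_add_left ?_ _)
        refine (norm_sub_le _ _).trans (add_le_add_left ?_ _)
        refine (norm_add_le _ _).trans (add_le_add_left ?_ _)
        exact norm_sub_le _ _
    _ ≤ _ := by
        simp only [norm_mul, hI, hh, Complex.norm_natCast]
        linarith

end CircleRotation

theorem mainTheorem5 :
    -- partial Birkhoff summation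
    (∀ (α : ℝ), Irrational α →
      ∀ (ψ φ : UnitAddCircle → ℂ) (C : ℝ≥0) (B : ℝ), LipschitzWith C ψ →
        (∀ N : ℕ, ‖CircleRotation.birkhoffS α φ N‖ ≤ B * N) →
        BddAbove (Set.range fun x : UnitAddCircle => ‖ψ x‖) ∧
        ∀ (M : ℤ) (N : ℕ),
          ‖CircleRotation.birkhoffS α (fun x => ψ (M • x) * φ x) N‖ ≤
            B * N * (1 / 2 * C * ‖((M * α : ℝ) : UnitAddCircle)‖ * ((N : ℝ) - 1)
              + ⨆ x : UnitAddCircle, ‖ψ x‖)) ∧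
    -- the bounds for rotation numbers of constant type
    (∀ (α : ℝ), CircleRotation.IsConstantType α →
      (∃ K : ℝ, ∀ n : ℕ,
        ‖CircleRotation.birkhoffS α
            (fun x => (CircleRotation.cotPi x : ℂ) *
              CircleRotation.e (CircleRotation.quasiperiod α n • x))
            (CircleRotation.quasiperiod α n - 1)‖ ≤ K * CircleRotation.quasiperiod α n) ∧
      (∃ K : ℝ, ∀ n : ℕ,
        ‖CircleRotation.birkhoffS α
            (fun x => CircleRotation.e (CircleRotation.quasiperiod α n • x) /
              (CircleRotation.signedCoord x : ℂ))
            (CircleRotation.quasiperiod α n - 1)‖ ≤ K * CircleRotation.quasiperiod α n) ∧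
      (∃ K : ℝ, ∀ n : ℕ,
        ‖CircleRotation.exp2 α (CircleRotation.quasiperiod α n)‖ ≤
          K * CircleRotation.quasiperiod α n)) := by
  open CircleRotation in
  refine ⟨fun α _ ψ φ C B hψ hφ ↦ ?_, fun α hα ↦ ⟨?_, ?_, exists_norm_exp2_le hα⟩⟩
  · have hbdd : BddAbove (Set.range fun x : UnitAddCircle => ‖ψ x‖) :=
      (isCompact_range hψ.continuous.norm).bddAbove
    exact ⟨hbdd, norm_birkhoffS_mul_le hψ (fun x ↦ le_ciSup hbdd x) hφ⟩
  · obtain ⟨B, hB⟩ := exists_norm_birkhoffS_cotPi_le hα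
    refine ⟨B * (Real.pi + 1), fun n ↦ ?_⟩
    simp only [mul_comm (Complex.ofReal _)]
    exact norm_birkhoffS_e_quasiperiod_mul_le hα.1 hB n
  · obtain ⟨B, hB⟩ := exists_norm_birkhoffS_inv_signedCoord_le hα
    refine ⟨B * (Real.pi + 1), fun n ↦ ?_⟩
    simp only [div_eq_mul_inv]
    exact norm_birkhoffS_e_quasiperiod_mul_le hα.1 hB n
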